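/- Let $H$ be a complex Hilbert space, let $A$ be a positive (i.e. positive semidefinite) bounded linear operator on $H$, and let $\mathcal S\subseteq H$ be a closed subspace with orthogonal projection $P_{\mathcal S}$. Write $L(H)^+$ for the positive bounded operators with the usual order, $R(X)$ for the range of $X$, and, for orthogonal projections $P,Q$, write $P\wedge Q$ for the orthogonal projection onto $R(P)\cap R(Q)$. For a self-adjoint bounded operator $B$ and a Borel set $\Delta\subseteq\mathbb R$, let $\chi_\Delta(B)=E_B(\Delta)$, where $E_B$ is the spectral measure of $B$. For $B\in L(H)^+$, the shorted operator is $$\Sigma(\mathcal S,B)=\max\{X\in L(H)^+ : X\le B,\ R(X)\subseteq\mathcal S\},$$ and the spectral shorted operator is $$\rho(\mathcal S,A)=\inf_{t\ge 1}\Sigma(\mathcal S,A^t)^{1/t}=\lim_{t\to+\infty}\Sigma(\mathcal S,A^t)^{1/t}$$ (limit in the strong operator topology). A left spectral resolution is a map $f:\mathbb R\to L(H)$ whose values are orthogonal projections, which is non-increasing, continuous on the left in the strong operator topology, and for which there are $m,M\in\mathbb R$ with $f(\lambda)=I$ for $\lambda<m$ and $f(\lambda)=0$ for $\lambda>M$.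 The operator defined by $f$ is the self-adjoint bounded operator $B$ with $\chi_{[\lambda,\infty)}(B)=f(\lambda)$ for all $\lambda\in\mathbb R$. **Theorem 4.1.** The maximum defining $\Sigma(\mathcal S,A^t)$ exists for every $t\ge1$, and the infimum and the limit defining $\rho(\mathcal S,A)$ exist and coincide. The map $$f(\lambda)=\begin{cases}\chi_{[\lambda,\infty)}(A)\wedge P_{\mathcal S}, & \lambda>0,\\ I, & \lambda\le 0,\end{cases}$$ is a left spectral resolution, and $\rho(\mathcal S,A)$ is the operator defined by it: a bounded operator $B$ is self-adjoint with $\chi_{[\lambda,\infty)}(B)=f(\lambda)$ for all $\lambda\in\mathbb R$ if and only if $B=\rho(\mathcal S,A)$. In other words, for every $\lambda>0$, $$\chi_{[\lambda,\infty)}(\rho(\mathcal S,A))=\chi_{[\lambda,\infty)}(A)\wedge P_{\mathcal S},$$ and $\rho(\mathcal S,A)$ is the only positive bounded operator with this property. -/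

import Mathlib

open scoped InnerProductSpace NNReal

namespace SpectralShorted

section SpectralMeasure

variable {H : Type*} [NormedAddCommGroup H] [InnerProductSpace ℂ H] [CompleteSpace H]

/-- The positive functional `φ ↦ ⟪x, φ(A) x⟫` on the compactly supported continuous functions. -/
noncomputable def scalarFunctional (A : H →L[ℂ] H) (x : H) :
    CompactlySupportedContinuousMap ℝ ℝ →ₚ[ℝ] ℝ :=
  PositiveLinearMap.mk₀
    { toFun := fun φ => (⟪x, cfc φ A x⟫_ℂ).re
      map_add' := fun φ ψ => by
        have h : cfc (⇑(φ + ψ)) A = cfc φ A + cfc ψ A :=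
          cfc_add A φ ψ φ.continuous.continuousOn ψ.continuous.continuousOn
        rw [h, add_apply, inner_add_right, Complex.add_re]
      map_smul' := fun c φ => by
        have h : cfc (⇑(c • φ)) A = c • cfc φ A :=
          cfc_smul c φ A φ.continuous.continuousOn
        rw [h, smul_apply, inner_smul_right_eq_smul, Complex.smul_re]
        rfl }
    (fun φ hφ => by
      have h : 0 ≤ cfc φ A := cfc_nonneg fun t _ => hφ t
      exact ((ContinuousLinearMap.nonneg_iff_isPositive _).1 h).re_inner_nonneg_right x)

/-- The scalar spectral measure `Δ ↦ ⟪x, E_A(Δ) x⟫` of a self-adjoint operator `A`: the measure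
representing `φ ↦ ⟪x, φ(A) x⟫`. -/
noncomputable def scalarSpectralMeasure (A : H →L[ℂ] H) (x : H) : MeasureTheory.Measure ℝ :=
  RealRMK.rieszMeasure (scalarFunctional A x)

theorem integral_scalarSpectralMeasure (A : H →L[ℂ] H) (x : H)
    (φ : CompactlySupportedContinuousMap ℝ ℝ) :
    ∫ t, φ t ∂(scalarSpectralMeasure A x) = (⟪x, cfc φ A x⟫_ℂ).re :=
  RealRMK.integral_rieszMeasure (scalarFunctional A x) φ

theorem scalarSpectralMeasure_univ_le (A : H →L[ℂ] H) (x : H) :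
    scalarSpectralMeasure A x Set.univ ≤ ENNReal.ofReal (‖x‖ ^ 2) := by
  have hmono : Monotone fun n : ℕ => Set.Icc (-(n : ℝ)) n := fun m n hmn => by
    have : (m : ℝ) ≤ n := by exact_mod_cast hmn
    exact Set.Icc_subset_Icc (by linarith) this
  have huniv : (⋃ n : ℕ, Set.Icc (-(n : ℝ)) n) = Set.univ := by
    refine Set.eq_univ_of_forall fun t => Set.mem_iUnion.2 ?_
    obtain ⟨n, hn⟩ := exists_nat_ge |t|
    exact ⟨n, abs_le.1 hn⟩
  rw [← huniv, hmono.measure_iUnion]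
  refine iSup_le fun n => ?_
  obtain ⟨f, hf1, -, hfc, hf01⟩ := exists_continuous_one_zero_of_isCompact
    (isCompact_Icc : IsCompact (Set.Icc (-(n : ℝ)) n)) isClosed_empty (Set.disjoint_empty _)
  let φ : CompactlySupportedContinuousMap ℝ ℝ := ⟨f, hfc⟩
  refine (RealRMK.rieszMeasure_le_of_eq_one (scalarFunctional A x) (f := φ)
    (fun t => (hf01 t).1) isCompact_Icc (fun t ht => hf1 ht)).trans ?_
  refine ENNReal.ofReal_le_ofReal ?_
  change (⟪x, cfc φ A x⟫_ℂ).re ≤ _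
  have hn : ‖cfc φ A‖ ≤ 1 := norm_cfc_le zero_le_one fun t _ => by
    have h0 : 0 ≤ φ t := (hf01 t).1
    have h1 : φ t ≤ 1 := (hf01 t).2
    rwa [Real.norm_eq_abs, abs_of_nonneg h0]
  calc (⟪x, cfc φ A x⟫_ℂ).re ≤ ‖⟪x, cfc φ A x⟫_ℂ‖ := Complex.re_le_norm _
    _ ≤ ‖x‖ * ‖cfc φ A x‖ := norm_inner_le_norm _ _
    _ ≤ ‖x‖ * (1 * ‖x‖) := by gcongr; exact (cfc φ A).le_of_opNorm_le hn x
    _ = ‖x‖ ^ 2 := by ring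

instance (A : H →L[ℂ] H) (x : H) : MeasureTheory.IsFiniteMeasure (scalarSpectralMeasure A x) :=
  ⟨(scalarSpectralMeasure_univ_le A x).trans_lt ENNReal.ofReal_lt_top⟩

theorem scalarSpectralMeasure_real_le (A : H →L[ℂ] H) (x : H) (Δ : Set ℝ) :
    (scalarSpectralMeasure A x).real Δ ≤ ‖x‖ ^ 2 :=
  ENNReal.toReal_le_of_le_ofReal (by positivity)
    ((MeasureTheory.measure_mono (Set.subset_univ _)).trans (scalarSpectralMeasure_univ_le A x))

/-- A linear relation between quadratic forms passes to the scalar spectral measures. -/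
theorem scalarSpectralMeasure_relation (A : H →L[ℂ] H) (Δ : Set ℝ) (x y : Fin 3 → H)
    (c d : Fin 3 → ℝ≥0)
    (h : ∀ T : H →L[ℂ] H, ∑ i, (c i : ℝ) * (⟪x i, T (x i)⟫_ℂ).re =
      ∑ i, (d i : ℝ) * (⟪y i, T (y i)⟫_ℂ).re) :
    ∑ i, (c i : ℝ) * (scalarSpectralMeasure A (x i)).real Δ =
      ∑ i, (d i : ℝ) * (scalarSpectralMeasure A (y i)).real Δ := by
  have hint : ∀ (z : H) (φ : CompactlySupportedContinuousMap ℝ ℝ) (r : ℝ≥0),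
      MeasureTheory.Integrable φ (r • scalarSpectralMeasure A z) := fun z φ r =>
    φ.continuous.integrable_of_hasCompactSupport φ.hasCompactSupport
  have key : ∑ i, c i • scalarSpectralMeasure A (x i) =
      ∑ i, d i • scalarSpectralMeasure A (y i) := by
    refine MeasureTheory.Measure.ext_of_integral_eq_on_compactlySupported fun φ => ?_
    rw [MeasureTheory.integral_finsetSum_measure fun i _ => hint _ _ _,
      MeasureTheory.integral_finsetSum_measure fun i _ => hint _ _ _]
    simp only [MeasureTheory.integral_smul_nnreal_measure, integral_scalarSpectralMeasure]
    exact h (cfc φ A)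
  have key' := congrArg (fun m : MeasureTheory.Measure ℝ => (m Δ).toReal) key
  have hs : ∀ (z : H) (r : ℝ≥0), (r : ENNReal) * scalarSpectralMeasure A z Δ ≠ ⊤ := fun z r =>
    ENNReal.mul_ne_top ENNReal.coe_ne_top (MeasureTheory.measure_ne_top _ _)
  simp only [MeasureTheory.Measure.coe_finsetSum, Finset.sum_apply,
    MeasureTheory.Measure.smul_apply, ENNReal.smul_def, smul_eq_mul] at key'
  rw [ENNReal.toReal_sum fun i _ => hs _ _, ENNReal.toReal_sum fun i _ => hs _ _] at key'
  simpa [ENNReal.toReal_mul, MeasureTheory.measureReal_def] using key'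

/-- A bounded quadratic form comes from a bounded operator. -/
theorem exists_operator_of_quadratic (q : H → ℝ) (hq0 : ∀ x, 0 ≤ q x) (hq : ∀ x, q x ≤ ‖x‖ ^ 2)
    (hrel : ∀ (x y : Fin 3 → H) (c d : Fin 3 → ℝ≥0),
      (∀ T : H →L[ℂ] H, ∑ i, (c i : ℝ) * (⟪x i, T (x i)⟫_ℂ).re =
        ∑ i, (d i : ℝ) * (⟪y i, T (y i)⟫_ℂ).re) →
      ∑ i, (c i : ℝ) * q (x i) = ∑ i, (d i : ℝ) * q (y i)) :
    ∃ T : H →L[ℂ] H, ∀ x, ⟪x, T x⟫_ℂ = (q x : ℂ) := by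
  have hadd : ∀ x x' y, q (x + x' + y) + q (x - y) + q (x' - y) =
      q (x + x' - y) + q (x + y) + q (x' + y) := fun x x' y => by
    have := hrel ![x + x' + y, x - y, x' - y] ![x + x' - y, x + y, x' + y] 1 1 fun T => by
      simp [Fin.sum_univ_succ]
      ring
    simpa [Fin.sum_univ_succ, add_assoc] using this
  have hsmul : ∀ (r : ℝ≥0) x y, q ((r : ℂ) • x + y) + r * q (x - y) =
      q ((r : ℂ) • x - y) + r * q (x + y) := fun r x y => by
    have := hrel ![(r : ℂ) • x + y, x - y, 0] ![(r : ℂ) • x - y, x + y, 0] ![1, r, 0] ![1, r, 0]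
      fun T => by
        simp [Fin.sum_univ_succ]
        ring
    simpa [Fin.sum_univ_succ, add_assoc] using this
  have hI : ∀ x, q (Complex.I • x) = q x := fun x => by
    have := hrel ![Complex.I • x, 0, 0] ![x, 0, 0] ![1, 0, 0] ![1, 0, 0] fun T => by
        simp [Fin.sum_univ_succ]
    simpa [Fin.sum_univ_succ] using this
  have hsq : ∀ (r : ℝ≥0) x, q ((r : ℂ) • x) = r ^ 2 * q x := fun r x => by
    have := hrel ![(r : ℂ) • x, 0, 0] ![x, 0, 0] ![1, 0, 0] ![r ^ 2, 0, 0] fun T => by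
        simp [Fin.sum_univ_succ]
        ring
    simpa [Fin.sum_univ_succ] using this
  have hneg : ∀ x, q (-x) = q x := fun x => by
    rw [← hI x, ← hI (Complex.I • x), smul_smul, Complex.I_mul_I, neg_one_smul]
  -- the real part of the sesquilinear form
  obtain ⟨b, hb⟩ : ∃ b : H → H → ℝ, ∀ x y, b x y = (q (x + y) - q (x - y)) / 4 := ⟨_, fun _ _ => rfl⟩
  have b_add : ∀ x x' y, b (x + x') y = b x y + b x' y := fun x x' y => by
    rw [hb, hb, hb]; linarith [hadd x x' y]
  have b_symm : ∀ x y, b x y = b y x := fun x y => by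
    rw [hb, hb, add_comm x y, ← hneg (x - y), neg_sub]
  have b_neg : ∀ x y, b (-x) y = -b x y := fun x y => by
    rw [hb, hb, ← hneg (-x + y), ← hneg (-x - y), neg_add, neg_sub, neg_neg, sub_neg_eq_add,
      ← sub_eq_add_neg, add_comm y x]
    ring
  have b_nn : ∀ (r : ℝ≥0) x y, b ((r : ℂ) • x) y = r * b x y := fun r x y => by
    rw [hb, hb]; linarith [hsmul r x y]
  have b_real : ∀ (r : ℝ) x y, b ((r : ℂ) • x) y = r * b x y := fun r x y => by
    rcases le_total 0 r with h | h
    · exact b_nn ⟨r, h⟩ x y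
    · obtain ⟨s, hs⟩ : ∃ s : ℝ≥0, (s : ℝ) = -r := ⟨⟨-r, by linarith⟩, rfl⟩
      have h3 := b_nn s (-x) y
      rw [hs, Complex.ofReal_neg, neg_smul_neg, b_neg] at h3
      rw [h3]; ring
  have b_I : ∀ x y, b (Complex.I • x) y = -b x (Complex.I • y) := fun x y => by
    have h1 : Complex.I • x + y = Complex.I • (x - Complex.I • y) := by
      rw [smul_sub, smul_smul, Complex.I_mul_I]; simp
    have h2 : Complex.I • x - y = Complex.I • (x + Complex.I • y) := by
      rw [smul_add, smul_smul, Complex.I_mul_I]; simp [sub_eq_add_neg]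
    rw [hb, hb, h1, h2, hI, hI]; ring
  have b_decomp : ∀ (c : ℂ) x y, b (c • x) y = c.re * b x y + c.im * b (Complex.I • x) y :=
    fun c x y => by
      conv_lhs => rw [← Complex.re_add_im c, add_smul, mul_smul, b_add, b_real, b_real]
  have b_bound : ∀ x y, |b x y| ≤ ‖x‖ * ‖y‖ := by
    have h1 : ∀ x y, |b x y| ≤ (‖x‖ ^ 2 + ‖y‖ ^ 2) / 2 := fun x y => by
      have hp := parallelogram_law_with_norm ℂ x y
      rw [hb, abs_le]
      constructor <;> nlinarith [hq0 (x + y), hq0 (x - y), hq (x + y), hq (x - y)]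
    have h2 : ∀ (s t : ℝ) x y, 0 < s → 0 < t → ‖x‖ = s → ‖y‖ = t → |b x y| ≤ s * t := by
      intro s t x y hs ht hx hy
      have h3 := h1 (((s⁻¹ : ℝ) : ℂ) • x) (((t⁻¹ : ℝ) : ℂ) • y)
      rw [b_real, b_symm, b_real, b_symm, norm_smul, norm_smul, hx, hy, Complex.norm_real,
        Complex.norm_real, Real.norm_of_nonneg (by positivity), Real.norm_of_nonneg (by positivity),
        inv_mul_cancel₀ hs.ne', inv_mul_cancel₀ ht.ne', abs_mul, abs_mul,
        abs_of_pos (inv_pos.2 hs), abs_of_pos (inv_pos.2 ht)] at h3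
      have h4 : s * t * (s⁻¹ * (t⁻¹ * |b x y|)) ≤ s * t * 1 := by
        gcongr; linarith
      have h5 : s * t * (s⁻¹ * (t⁻¹ * |b x y|)) = |b x y| := by field_simp
      linarith
    have h0 : ∀ y, b 0 y = 0 := fun y => by simpa using b_real 0 0 y
    intro x y
    rcases eq_or_ne x 0 with rfl | hx
    · simp [h0]
    rcases eq_or_ne y 0 with rfl | hy
    · simp [b_symm x 0, h0]
    exact h2 _ _ x y (norm_pos_iff.2 hx) (norm_pos_iff.2 hy) rfl rfl
  have b_II : ∀ x y, b (Complex.I • Complex.I • x) y = -b x y := fun x y => by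
    rw [smul_smul, Complex.I_mul_I, neg_one_smul, b_neg]
  let B : H →ₗ⋆[ℂ] H →ₗ[ℂ] ℂ := LinearMap.mk₂'ₛₗ (starRingEnd ℂ) (RingHom.id ℂ)
    (fun x y => (⟨b x y, b (Complex.I • x) y⟩ : ℂ))
    (fun x x' y => by apply Complex.ext <;> simp [b_add])
    (fun c x y => by
      apply Complex.ext
      · simp [b_decomp c x y]
      · simp only [smul_smul, mul_comm Complex.I c]
        simp [b_decomp (c * Complex.I) x y]
        ring)
    (fun x y y' => by
      apply Complex.ext <;> simp [b_symm _ (y + y'), b_add, b_symm _ x, b_symm _ (Complex.I • x)])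
    (fun c x y => by
      have h1 : ∀ z, b z (c • y) = c.re * b z y - c.im * b (Complex.I • z) y := fun z => by
        rw [b_symm, b_decomp, b_symm y z, b_I y z, b_symm y]; ring
      apply Complex.ext
      · simp [h1]
      · simp [h1, b_II])
  have hB : ∀ x y, ‖B x y‖ ≤ 2 * ‖x‖ * ‖y‖ := fun x y => by
    have h1 := b_bound x y
    have h2 := b_bound (Complex.I • x) y
    rw [norm_smul, Complex.norm_I, one_mul] at h2
    calc ‖B x y‖ ≤ |b x y| + |b (Complex.I • x) y| := Complex.norm_le_abs_re_add_abs_im _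
      _ ≤ 2 * ‖x‖ * ‖y‖ := by linarith
  let T := InnerProductSpace.continuousLinearMapOfBilin (B.mkContinuous₂ 2 hB)
  have hT : ∀ x, ⟪T x, x⟫_ℂ = (q x : ℂ) := fun x => by
    rw [InnerProductSpace.continuousLinearMapOfBilin_apply]
    change (⟨b x x, b (Complex.I • x) x⟩ : ℂ) = _
    have h0 : q 0 = 0 := le_antisymm (by simpa using hq 0) (hq0 0)
    have h2 : q (x + x) = 4 * q x := by
      have h := hsq 2 x
      rw [← two_smul ℂ x]
      norm_num at h
      exact h
    apply Complex.ext
    · simp only [hb, sub_self, h0, h2, Complex.ofReal_re]; ring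
    · have h3 := b_I x x
      rw [b_symm x] at h3
      simp only [Complex.ofReal_im]; linarith
  refine ⟨T, fun x => ?_⟩
  rw [← inner_conj_symm, hT, Complex.conj_ofReal]

theorem exists_spectralMeasure (A : H →L[ℂ] H) (Δ : Set ℝ) :
    ∃ T : H →L[ℂ] H, ∀ x, ⟪x, T x⟫_ℂ = ((scalarSpectralMeasure A x).real Δ : ℂ) :=
  exists_operator_of_quadratic _ (fun _ => MeasureTheory.measureReal_nonneg)
    (fun x => scalarSpectralMeasure_real_le A x Δ)
    (fun x y c d h => scalarSpectralMeasure_relation A Δ x y c d h)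

/-- The spectral measure `E_A(Δ) = χ_Δ(A)` of a self-adjoint operator `A`: the (unique) bounded
operator whose quadratic form at `x` is the mass of `Δ` under the scalar spectral measure. -/
noncomputable def spectralMeasure (A : H →L[ℂ] H) (Δ : Set ℝ) : H →L[ℂ] H :=
  Classical.choose (exists_spectralMeasure A Δ)

theorem inner_spectralMeasure (A : H →L[ℂ] H) (Δ : Set ℝ) (x : H) :
    ⟪x, spectralMeasure A Δ x⟫_ℂ = ((scalarSpectralMeasure A x).real Δ : ℂ) :=
  Classical.choose_spec (exists_spectralMeasure A Δ) x

/-- The orthogonal projection onto (the closure of) a subspace. -/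
noncomputable def orthProj (K : Submodule ℂ H) : H →L[ℂ] H :=
  K.topologicalClosure.starProjection

/-- `P ∧ Q`: the orthogonal projection onto `R(P) ∩ R(Q)`. The ranges of projections are closed, so
the closure taken in `orthProj` changes nothing when `P` and `Q` are orthogonal projections. -/
noncomputable def projMeet (P Q : H →L[ℂ] H) : H →L[ℂ] H :=
  orthProj (P.range ⊓ Q.range)

/-- `f` is a left spectral resolution; continuity on the left refers to the strong operator
topology. -/
structure IsLeftSpectralResolution (f : ℝ → H →L[ℂ] H) : Prop where
  bounds : ∃ m M : ℝ, (∀ l < m, f l = 1) ∧ ∀ l > M, f l = 0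
  projection : ∀ l, IsStarProjection (f l)
  antitone : ∀ l u, l ≤ u → f u ≤ f l
  left_continuous : ∀ (x : H) (l : ℝ), ContinuousWithinAt (fun u => f u x) (Set.Iic l) l

/-- `B` is an operator defined by the left spectral resolution `f`: it is self-adjoint and
`f l = χ_{[l, ∞)}(B)` for all real `l`. -/
def IsOperatorOf (f : ℝ → H →L[ℂ] H) (B : H →L[ℂ] H) : Prop :=
  IsSelfAdjoint B ∧ ∀ l : ℝ, f l = spectralMeasure B (Set.Ici l)

end SpectralMeasure

section Shorted

variable {H : Type*} [NormedAddCommGroup H] [InnerProductSpace ℂ H] [CompleteSpace H]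

/-- `X` is the maximum of the positive operators below `A` whose range lies in `S`. -/
def IsShorted (S : Submodule ℂ H) (A X : H →L[ℂ] H) : Prop :=
  IsGreatest {Y : H →L[ℂ] H | 0 ≤ Y ∧ Y ≤ A ∧ Y.range ≤ S} X

open Classical in
/-- The shorted operator `Σ(S, A)` (with the value `0` if the maximum does not exist). -/
noncomputable def shorted (S : Submodule ℂ H) (A : H →L[ℂ] H) : H →L[ℂ] H :=
  if h : ∃ X, IsShorted S A X then h.choose else 0

/-- The operators `Σ(S, A ^ t) ^ (1 / t)`. -/
noncomputable def shortedPower (S : Submodule ℂ H) (A : H →L[ℂ] H) (t : ℝ) : H →L[ℂ] H :=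
  shorted S (A ^ t) ^ (1 / t)

/-- `R` is the infimum of the operators `Σ(S, A ^ t) ^ (1 / t)`, `t ≥ 1`, and also their limit in
the strong operator topology as `t → ∞`. -/
def IsSpectralShorted (S : Submodule ℂ H) (A R : H →L[ℂ] H) : Prop :=
  IsGLB (shortedPower S A '' Set.Ici 1) R ∧
    ∀ x : H, Filter.Tendsto (fun t : ℝ => shortedPower S A t x) Filter.atTop (nhds (R x))

open Classical in
/-- The spectral shorted operator `ρ(S, A)` (with the value `0` if the infimum or the limit does not
exist). -/
noncomputable def spectralShorted (S : Submodule ℂ H) (A : H →L[ℂ] H) : H →L[ℂ] H :=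
  if h : ∃ R, IsSpectralShorted S A R then h.choose else 0

open Classical in
/-- The function `l ↦ χ_{[l, ∞)}(A) ∧ P_S` for `l > 0` and `l ↦ I` for `l ≤ 0`. -/
noncomputable def shortedResolution (S : Submodule ℂ H) (A : H →L[ℂ] H) (l : ℝ) : H →L[ℂ] H :=
  if 0 < l then projMeet (spectralMeasure A (Set.Ici l)) (orthProj S) else 1

end Shorted

end SpectralShorted

namespace SpectralShorted

/-! ### Quadratic forms, operator order and strong limits. -/

section Order

open Filter Topology ComplexOrder

variable {H : Type*} [NormedAddCommGroup H] [InnerProductSpace ℂ H] [CompleteSpace H]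

/-! Write T_t = Σ(S, A^t)^(1/t). Two facts about powers drive the proof. By the Löwner–Heinz
inequality (`CFC.rpow_le_rpow`), Σ(S, A^t)^(s/t) ≤ A^s for 0 < s ≤ t; when s ≥ 1 its range still
lies in S, so maximality of Σ(S, A^s) makes T_t decreasing on [1, ∞). A decreasing family of
positive operators converges strongly, and the limit R is its infimum.

The second fact is that projections see all powers at once: for B ≥ 0, l > 0 and a projection Q, Q ≤
χ_[l,∞)(B) holds as soon as l^n Q ≤ B^n for every n (`le_spectralMeasure_Ici`), and conversely l^u
χ_[l,∞)(B) ≤ B^u (`rpow_smul_spectralMeasure_Ici_le`). Since T_t^n ≤ A^n once t ≥ n, the limit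
satisfies R^n ≤ A^n for all n, so χ_[l,∞)(R) ≤ χ_[l,∞)(A); its range lies in S because that of R
does. Conversely, for the meet Q, l^t Q competes in the maximum defining Σ(S, A^t), whence l^n Q ≤
T_t^n for large t, l^n Q ≤ R^n, and Q ≤ χ_[l,∞)(R).

The resolution is thus the spectral resolution of R, and uniqueness holds because half-lines
determine the scalar spectral measures. -/

theorem nonneg_iff_inner (T : H →L[ℂ] H) : 0 ≤ T ↔ ∀ x, 0 ≤ ⟪x, T x⟫_ℂ := by
  rw [ContinuousLinearMap.nonneg_iff_isPositive]
  refine ⟨fun h x => h.inner_nonneg_right x, fun h => ?_⟩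
  refine (ContinuousLinearMap.isPositive_iff_complex T).2 fun x => ?_
  obtain ⟨h2, h3⟩ := Complex.nonneg_iff.1 (h x)
  have h1 : ⟪T x, x⟫_ℂ = ⟪x, T x⟫_ℂ := by
    rw [← inner_conj_symm]
    exact Complex.ext (Complex.conj_re _) (by simp only [Complex.conj_im]; linarith)
  rw [h1]
  exact ⟨Complex.ext (by simp) (by simpa using h3), h2⟩

theorem le_iff_inner (T U : H →L[ℂ] H) : T ≤ U ↔ ∀ x, ⟪x, T x⟫_ℂ ≤ ⟪x, U x⟫_ℂ := by
  rw [← sub_nonneg, nonneg_iff_inner]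
  simp

theorem le_iff_re_inner {T U : H →L[ℂ] H} (hT : IsSelfAdjoint T) (hU : IsSelfAdjoint U) :
    T ≤ U ↔ ∀ x, (⟪x, T x⟫_ℂ).re ≤ (⟪x, U x⟫_ℂ).re := by
  rw [ContinuousLinearMap.le_def, ContinuousLinearMap.isPositive_def']
  refine ⟨fun h x => ?_, fun h => ⟨hU.sub hT, fun x => ?_⟩⟩
  · have := h.2 x
    rw [ContinuousLinearMap.reApplyInnerSelf_apply, ← inner_re_symm] at this
    simpa [inner_sub_right] using this
  · rw [ContinuousLinearMap.reApplyInnerSelf_apply, ← inner_re_symm]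
    simpa [inner_sub_right] using h x

theorem re_inner_mono {T U : H →L[ℂ] H} (h : T ≤ U) (x : H) :
    (⟪x, T x⟫_ℂ).re ≤ (⟪x, U x⟫_ℂ).re :=
  (Complex.le_def.1 ((le_iff_inner T U).1 h x)).1

theorem eq_of_re_inner_eq {T U : H →L[ℂ] H} (hT : IsSelfAdjoint T) (hU : IsSelfAdjoint U)
    (h : ∀ x, (⟪x, T x⟫_ℂ).re = (⟪x, U x⟫_ℂ).re) : T = U :=
  le_antisymm ((le_iff_re_inner hT hU).2 fun x => (h x).le)
    ((le_iff_re_inner hU hT).2 fun x => (h x).ge)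

/-- The Cauchy–Schwarz inequality for the form of a positive operator. -/
theorem norm_apply_sq_le {T : H →L[ℂ] H} (hT : 0 ≤ T) (x : H) :
    ‖T x‖ ^ 2 ≤ ‖T‖ * (⟪x, T x⟫_ℂ).re := by
  have h0 := CFC.sqrt_nonneg T
  have hsa : IsSelfAdjoint (CFC.sqrt T) := IsSelfAdjoint.of_nonneg h0
  have hmul := CFC.sqrt_mul_sqrt_self T hT
  have h1 : ‖CFC.sqrt T‖ ^ 2 = ‖T‖ := by
    rw [← hsa.norm_mul_self, hmul]
  have happ : T x = CFC.sqrt T (CFC.sqrt T x) := by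
    conv_lhs => rw [← hmul]
    rfl
  have h2 : ‖CFC.sqrt T x‖ ^ 2 = (⟪x, T x⟫_ℂ).re := by
    rw [happ, ← ContinuousLinearMap.adjoint_inner_left, hsa.adjoint_eq]
    exact (inner_self_eq_norm_sq (𝕜 := ℂ) _).symm
  rw [← h2, ← h1, ← mul_pow, happ]
  gcongr
  exact ContinuousLinearMap.le_opNorm _ _

theorem apply_eq_zero_of_re_inner {T : H →L[ℂ] H} (hT : 0 ≤ T) {x : H}
    (h : (⟪x, T x⟫_ℂ).re ≤ 0) : T x = 0 := by
  have h1 := norm_apply_sq_le hT x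
  have : ‖T x‖ ^ 2 ≤ 0 := h1.trans (mul_nonpos_of_nonneg_of_nonpos (norm_nonneg _) h)
  exact norm_eq_zero.1 (pow_eq_zero_iff (two_ne_zero) |>.1 (le_antisymm this (by positivity)))

/-- A range is contained in a closed subspace iff the operator vanishes on the complement. -/
theorem range_le_iff {T : H →L[ℂ] H} (hT : IsSelfAdjoint T) {S : Submodule ℂ H}
    (hS : IsClosed (S : Set H)) : T.range ≤ S ↔ ∀ z ∈ Sᗮ, T z = 0 := by
  have hsymm : ∀ x y, ⟪T x, y⟫_ℂ = ⟪x, T y⟫_ℂ := fun x y => by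
    rw [← ContinuousLinearMap.adjoint_inner_left, hT.adjoint_eq]
  constructor
  · intro h z hz
    refine ext_inner_left ℂ fun v => ?_
    rw [← hsymm, inner_zero_right]
    exact hz _ (h ⟨v, rfl⟩)
  · rintro h _ ⟨v, rfl⟩
    have : CompleteSpace S := hS.completeSpace_coe
    rw [← Submodule.orthogonal_orthogonal S]
    intro z hz
    change ⟪z, T v⟫_ℂ = 0
    rw [← hsymm, h z hz, inner_zero_left]

section Limits

variable {ι : Type*} {l : Filter ι} [l.NeBot]

theorem le_of_tendsto_apply {T : ι → H →L[ℂ] H} {R U : H →L[ℂ] H}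
    (h : ∀ x, Tendsto (fun i => T i x) l (𝓝 (R x))) (hle : ∀ᶠ i in l, T i ≤ U) : R ≤ U := by
  rw [le_iff_inner]
  intro x
  have := Complex.orderClosedTopology
  exact le_of_tendsto (tendsto_const_nhds.inner (h x))
    (hle.mono fun i hi => (le_iff_inner _ _).1 hi x)

theorem ge_of_tendsto_apply {T : ι → H →L[ℂ] H} {R U : H →L[ℂ] H}
    (h : ∀ x, Tendsto (fun i => T i x) l (𝓝 (R x))) (hle : ∀ᶠ i in l, U ≤ T i) : U ≤ R := by
  rw [le_iff_inner]
  intro x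
  have := Complex.orderClosedTopology
  exact ge_of_tendsto (tendsto_const_nhds.inner (h x))
    (hle.mono fun i hi => (le_iff_inner _ _).1 hi x)

/-- Powers of a bounded strongly convergent family converge strongly. -/
theorem tendsto_pow_apply {T : ι → H →L[ℂ] H} {R : H →L[ℂ] H} {C : ℝ}
    (hC : ∀ᶠ i in l, ‖T i‖ ≤ C) (h : ∀ x, Tendsto (fun i => T i x) l (𝓝 (R x))) (n : ℕ) (x : H) :
    Tendsto (fun i => (T i ^ n) x) l (𝓝 ((R ^ n) x)) := by
  induction n with
  | zero => simp
  | succ n ih =>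
    have e : ∀ U : H →L[ℂ] H, (U ^ (n + 1)) x = U ((U ^ n) x) := fun U => by
      rw [pow_succ']; rfl
    simp only [e]
    rw [tendsto_iff_norm_sub_tendsto_zero] at ih ⊢
    have h2 := tendsto_iff_norm_sub_tendsto_zero.1 (h ((R ^ n) x))
    have h3 := (ih.const_mul C).add h2
    rw [mul_zero, add_zero] at h3
    refine squeeze_zero' (.of_forall fun i => norm_nonneg _) ?_ h3
    filter_upwards [hC] with i hi
    calc ‖T i ((T i ^ n) x) - R ((R ^ n) x)‖
        = ‖T i ((T i ^ n) x - (R ^ n) x) + (T i ((R ^ n) x) - R ((R ^ n) x))‖ := by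
          rw [map_sub, sub_add_sub_cancel]
      _ ≤ ‖T i ((T i ^ n) x - (R ^ n) x)‖ + ‖T i ((R ^ n) x) - R ((R ^ n) x)‖ := norm_add_le _ _
      _ ≤ C * ‖(T i ^ n) x - (R ^ n) x‖ + ‖T i ((R ^ n) x) - R ((R ^ n) x)‖ := by
          gcongr
          exact (T i).le_of_opNorm_le hi _

end Limits

/-- A decreasing family of positive operators converges strongly. -/
theorem exists_tendsto_of_antitoneOn {T : ℝ → H →L[ℂ] H} {a : ℝ} (h0 : ∀ t ≥ a, 0 ≤ T t)
    (hanti : ∀ s t, a ≤ s → s ≤ t → T t ≤ T s) :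
    ∃ R : H →L[ℂ] H, ∀ x, Tendsto (fun t => T t x) atTop (𝓝 (R x)) := by
  have hex : ∀ x, ∃ y, Tendsto (fun t => T t x) atTop (𝓝 y) := by
    intro x
    set q : ℝ → ℝ := fun t => (⟪x, T t x⟫_ℂ).re with hq
    obtain ⟨L, hL⟩ : ∃ L, Tendsto q atTop (𝓝 L) := by
      -- Freezing the family before `a` makes it monotone on all of ℝ.
      have hq' : Antitone fun t => q (max a t) := fun s t hst =>
        re_inner_mono (hanti _ _ (le_max_left _ _) (max_le_max_left _ hst)) x
      have hb : BddBelow (Set.range fun t => q (max a t)) := by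
        refine ⟨0, ?_⟩
        rintro _ ⟨t, rfl⟩
        simpa using re_inner_mono (h0 (max a t) (le_max_left _ _)) x
      refine ⟨_, (tendsto_atTop_ciInf hq' hb).congr' ?_⟩
      filter_upwards [eventually_ge_atTop a] with t ht
      simp [max_eq_right ht]
    have hqc := hL.cauchy_map
    refine cauchy_map_iff_exists_tendsto.1 ?_
    rw [Metric.cauchy_iff] at hqc ⊢
    refine ⟨inferInstance, fun ε hε => ?_⟩
    -- Chosen because ‖(T u - T v) x‖² ≤ ‖T a‖ (q u - q v); the `+ 1` avoids division by zero.
    obtain ⟨s, hs, hs'⟩ := hqc.2 (ε ^ 2 / (‖T a‖ + 1)) (by positivity)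
    refine ⟨(fun t => T t x) '' {t | a ≤ t ∧ q t ∈ s},
      image_mem_map (inter_mem (Ici_mem_atTop a) hs), ?_⟩
    have key : ∀ u v, a ≤ u → u ≤ v → q u ∈ s → q v ∈ s → dist (T u x) (T v x) < ε := by
      intro u v hu huv hus hvs
      have hd := hs' _ hus _ hvs
      have hnn : 0 ≤ T u - T v := sub_nonneg.2 (hanti u v hu huv)
      have h1 := norm_apply_sq_le hnn x
      have h2 : ‖T u - T v‖ ≤ ‖T a‖ :=
        CStarAlgebra.norm_le_norm_of_nonneg_of_le hnn
          ((sub_le_self _ (h0 v (hu.trans huv))).trans (hanti a u le_rfl hu))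
      have h3 : (⟪x, (T u - T v) x⟫_ℂ).re = q u - q v := by
        simp [hq]
      have h4 : 0 ≤ q u - q v := by
        rw [← h3]
        simpa using re_inner_mono hnn x
      rw [h3] at h1
      rw [Real.dist_eq, abs_of_nonneg h4, lt_div_iff₀ (by positivity)] at hd
      rw [dist_eq_norm]
      refine lt_of_pow_lt_pow_left₀ 2 hε.le ?_
      rw [← sub_apply]
      nlinarith [mul_le_mul_of_nonneg_right h2 h4]
    rintro _ ⟨u, ⟨hu, hus⟩, rfl⟩ _ ⟨v, ⟨hv, hvs⟩, rfl⟩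
    rcases le_total u v with huv | huv
    · exact key u v hu huv hus hvs
    · rw [dist_comm]
      exact key v u hv huv hvs hus
  choose f hf using hex
  exact ⟨continuousLinearMapOfTendsto (f := f) T (tendsto_pi_nhds.2 hf), hf⟩

end Order

end SpectralShorted
namespace SpectralShorted

/-! ### Spectral projections of half-lines as strong limits of continuous functions. -/

section SpectralProjections

open Filter Topology MeasureTheory

variable {H : Type*} [NormedAddCommGroup H] [InnerProductSpace ℂ H] [CompleteSpace H]

/-- The integral formula for bounded continuous functions. -/
theorem integral_scalarSpectralMeasure_of_bounded (B : H →L[ℂ] H) (x : H)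
    {φ : ℝ → ℝ} (hφ : Continuous φ) {C : ℝ} (hC : ∀ t, |φ t| ≤ C) :
    ∫ t, φ t ∂(scalarSpectralMeasure B x) = (⟪x, cfc φ B x⟫_ℂ).re := by
  -- Compactly supported cutoffs: the integrals converge by dominated convergence, while the
  -- operator side is constant once `n ≥ ‖B‖`, since the spectrum is then inside the region where
  -- the cutoff is 1.
  let cut : ℕ → ℝ → ℝ := fun n t => max 0 (min 1 (n + 1 - |t|))
  have hcut1 : ∀ (n : ℕ) t, |t| ≤ (n : ℝ) → cut n t = 1 := fun n t ht => by
    simp only [cut]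
    rw [min_eq_left (by linarith), max_eq_right zero_le_one]
  have hcut : ∀ n t, |cut n t| ≤ 1 := fun n t => by
    rw [abs_of_nonneg (le_max_left _ _)]
    exact max_le zero_le_one (min_le_left _ _)
  have hcont : ∀ n, Continuous (cut n) := fun n => by fun_prop
  have hsupp : ∀ n, HasCompactSupport fun t => φ t * cut n t := fun n =>
    HasCompactSupport.intro (K := Set.Icc (-(n + 1 : ℝ)) (n + 1)) isCompact_Icc fun t ht => by
      have : (n : ℝ) + 1 < |t| := by
        by_contra h
        exact ht (abs_le.1 (not_lt.1 h))
      simp only [cut]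
      rw [max_eq_left ((min_le_right _ _).trans (by linarith)), mul_zero]
  let ψ : ℕ → CompactlySupportedContinuousMap ℝ ℝ := fun n =>
    ⟨⟨fun t => φ t * cut n t, hφ.mul (hcont n)⟩, hsupp n⟩
  have h1 : Tendsto (fun n => ∫ t, ψ n t ∂(scalarSpectralMeasure B x)) atTop
      (𝓝 (∫ t, φ t ∂(scalarSpectralMeasure B x))) := by
    refine tendsto_integral_of_dominated_convergence (fun _ => C)
      (fun n => (ψ n).continuous.aestronglyMeasurable) (integrable_const _)
      (fun n => .of_forall fun t => ?_) (.of_forall fun t => ?_)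
    · change ‖φ t * cut n t‖ ≤ C
      rw [norm_mul, Real.norm_eq_abs, Real.norm_eq_abs]
      have := mul_le_mul (hC t) (hcut n t) (abs_nonneg _) ((abs_nonneg _).trans (hC t))
      simpa using this
    · refine tendsto_const_nhds.congr' ?_
      obtain ⟨N, hN⟩ := exists_nat_ge |t|
      filter_upwards [eventually_ge_atTop N] with n hn
      have : |t| ≤ (n : ℝ) := hN.trans (by exact_mod_cast hn)
      change φ t = φ t * cut n t
      rw [hcut1 n t this, mul_one]
  refine tendsto_nhds_unique h1 (tendsto_const_nhds.congr' ?_)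
  obtain ⟨N, hN⟩ := exists_nat_ge ‖B‖
  filter_upwards [eventually_ge_atTop N] with n hn
  rw [integral_scalarSpectralMeasure]
  congr 3
  refine cfc_congr fun t ht => ?_
  have h2 : |t| ≤ ‖B‖ := by
    -- The bound by the norm uses ‖1‖ = 1; in the zero algebra the spectrum is empty.
    by_cases hnt : Nontrivial (H →L[ℂ] H)
    · simpa using spectrum.norm_le_norm_of_mem ht
    · rw [not_nontrivial_iff_subsingleton] at hnt
      simp at ht
  have : |t| ≤ (n : ℝ) := h2.trans (hN.trans (by exact_mod_cast hn))
  change φ t = φ t * cut n t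
  rw [hcut1 n t this, mul_one]

theorem spectralMeasure_nonneg (B : H →L[ℂ] H) (Δ : Set ℝ) : 0 ≤ spectralMeasure B Δ := by
  rw [nonneg_iff_inner]
  intro x
  rw [inner_spectralMeasure]
  exact Complex.zero_le_real.2 measureReal_nonneg

theorem isSelfAdjoint_spectralMeasure (B : H →L[ℂ] H) (Δ : Set ℝ) :
    IsSelfAdjoint (spectralMeasure B Δ) :=
  IsSelfAdjoint.of_nonneg (spectralMeasure_nonneg B Δ)

theorem re_inner_spectralMeasure (B : H →L[ℂ] H) (Δ : Set ℝ) (x : H) :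
    (⟪x, spectralMeasure B Δ x⟫_ℂ).re = (scalarSpectralMeasure B x).real Δ := by
  rw [inner_spectralMeasure, Complex.ofReal_re]

theorem spectralMeasure_mono (B : H →L[ℂ] H) {Δ Δ' : Set ℝ} (h : Δ ⊆ Δ') :
    spectralMeasure B Δ ≤ spectralMeasure B Δ' := by
  rw [le_iff_re_inner (isSelfAdjoint_spectralMeasure B _) (isSelfAdjoint_spectralMeasure B _)]
  intro x
  rw [re_inner_spectralMeasure, re_inner_spectralMeasure]
  exact measureReal_mono h

/-- A continuous function with values in `[0, 1]` which is `1` on `[l - 1 / k, ∞)` and `0` on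
`(-∞, l - 2 / k]`. -/
noncomputable def ramp (l : ℝ) (k : ℕ) (t : ℝ) : ℝ := max 0 (min 1 (k * (t - l) + 2))

theorem continuous_ramp (l : ℝ) (k : ℕ) : Continuous (ramp l k) := by
  unfold ramp; fun_prop

theorem ramp_nonneg (l : ℝ) (k : ℕ) (t : ℝ) : 0 ≤ ramp l k t := le_max_left _ _

theorem ramp_le_one (l : ℝ) (k : ℕ) (t : ℝ) : ramp l k t ≤ 1 :=
  max_le zero_le_one (min_le_left _ _)

theorem abs_ramp_le (l : ℝ) (k : ℕ) (t : ℝ) : |ramp l k t| ≤ 1 := by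
  rw [abs_of_nonneg (ramp_nonneg l k t)]
  exact ramp_le_one l k t

theorem ramp_eq_one {l : ℝ} {k : ℕ} {t : ℝ} (h : -1 ≤ k * (t - l)) : ramp l k t = 1 := by
  rw [ramp, min_eq_left (by linarith), max_eq_right zero_le_one]

theorem ramp_eq_zero {l : ℝ} {k : ℕ} {t : ℝ} (h : k * (t - l) ≤ -2) : ramp l k t = 0 := by
  rw [ramp, max_eq_left ((min_le_right _ _).trans (by linarith))]

theorem ramp_eq_one_of_le {l : ℝ} {k : ℕ} {t : ℝ} (h : l ≤ t) : ramp l k t = 1 :=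
  ramp_eq_one (by have := mul_nonneg k.cast_nonneg (sub_nonneg.2 h); linarith)

theorem tendsto_ramp (l t : ℝ) :
    Tendsto (fun k => ramp l k t) atTop (𝓝 ((Set.Ici l).indicator 1 t)) := by
  refine tendsto_const_nhds.congr' ?_
  rcases le_or_gt l t with h | h
  · filter_upwards with k
    rw [ramp_eq_one_of_le h, Set.indicator_of_mem (show t ∈ Set.Ici l from h), Pi.one_apply]
  · obtain ⟨N, hN⟩ := exists_nat_ge (2 / (l - t))
    filter_upwards [eventually_ge_atTop N] with k hk
    rw [Set.indicator_of_notMem (fun h' => absurd (Set.mem_Ici.1 h') (not_le.2 h)), ramp_eq_zero]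
    have h1 : 2 / (l - t) ≤ k := hN.trans (by exact_mod_cast hk)
    rw [div_le_iff₀ (by linarith)] at h1
    linarith

/-- The slack is essential: the ramp dominates the indicators of half-lines starting slightly to the
left of `l` as well, which is what left continuity rests on. -/
theorem spectralMeasure_Ici_le_cfc_ramp (B : H →L[ℂ] H) {l u : ℝ} {k : ℕ}
    (hu : -1 ≤ k * (u - l)) : spectralMeasure B (Set.Ici u) ≤ cfc (ramp l k) B := by
  rw [le_iff_re_inner (isSelfAdjoint_spectralMeasure B _) (cfc_predicate _ _)]
  intro x
  rw [re_inner_spectralMeasure,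
    ← integral_scalarSpectralMeasure_of_bounded B x (continuous_ramp l k) (abs_ramp_le l k),
    ← integral_indicator_one measurableSet_Ici]
  have hint : Integrable (ramp l k) (scalarSpectralMeasure B x) :=
    (integrable_const (1 : ℝ)).mono' (continuous_ramp l k).aestronglyMeasurable
      (.of_forall fun t => abs_ramp_le l k t)
  refine integral_mono ((integrable_const 1).indicator measurableSet_Ici) hint fun t => ?_
  refine Set.indicator_le' (fun t ht => ?_) (fun t _ => ramp_nonneg l k t) t
  rw [ramp_eq_one, Pi.one_apply]
  have := mul_le_mul_of_nonneg_left (sub_le_sub_right (Set.mem_Ici.1 ht) l) (Nat.cast_nonneg (α := ℝ) k) 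
  linarith

theorem tendsto_re_inner_cfc_ramp (B : H →L[ℂ] H) (l : ℝ) (x : H) :
    Tendsto (fun k => (⟪x, cfc (ramp l k) B x⟫_ℂ).re) atTop
      (𝓝 (⟪x, spectralMeasure B (Set.Ici l) x⟫_ℂ).re) := by
  simp only [re_inner_spectralMeasure,
    ← integral_scalarSpectralMeasure_of_bounded B x (continuous_ramp l _) (abs_ramp_le l _)]
  rw [← integral_indicator_one measurableSet_Ici]
  exact tendsto_integral_of_dominated_convergence (fun _ => 1)
    (fun k => (continuous_ramp l k).aestronglyMeasurable) (integrable_const _)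
    (fun k => .of_forall fun t => abs_ramp_le l k t) (.of_forall fun t => tendsto_ramp l t)

theorem norm_cfc_ramp_le (B : H →L[ℂ] H) (l : ℝ) (k : ℕ) : ‖cfc (ramp l k) B‖ ≤ 1 :=
  norm_cfc_le zero_le_one fun t _ => abs_ramp_le l k t

/-- The spectral projection of `[l, ∞)` is the strong limit of continuous functions of `B`. -/
theorem tendsto_cfc_ramp_apply (B : H →L[ℂ] H) (l : ℝ) (x : H) :
    Tendsto (fun k => cfc (ramp l k) B x) atTop (𝓝 (spectralMeasure B (Set.Ici l) x)) := by
  rw [tendsto_iff_norm_sub_tendsto_zero]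
  have hle : ∀ k, spectralMeasure B (Set.Ici l) ≤ cfc (ramp l k) B := fun k =>
    spectralMeasure_Ici_le_cfc_ramp B (by simp)
  have h1 := (tendsto_re_inner_cfc_ramp B l x).sub_const (⟪x, spectralMeasure B (Set.Ici l) x⟫_ℂ).re
  rw [sub_self] at h1
  -- The difference lies between 0 and a contraction, so Cauchy–Schwarz for its form turns
  -- convergence of forms into strong convergence.
  have h2 : Tendsto (fun k => ‖cfc (ramp l k) B x - spectralMeasure B (Set.Ici l) x‖ ^ 2) atTop
      (𝓝 0) := by
    refine squeeze_zero (fun k => by positivity) (fun k => ?_) h1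
    have hnn := sub_nonneg.2 (hle k)
    have h3 := norm_apply_sq_le hnn x
    have h4 : ‖cfc (ramp l k) B - spectralMeasure B (Set.Ici l)‖ ≤ 1 :=
      (CStarAlgebra.norm_le_norm_of_nonneg_of_le hnn
        (sub_le_self _ (spectralMeasure_nonneg B _))).trans (norm_cfc_ramp_le B l k)
    have h5 : 0 ≤ (⟪x, (cfc (ramp l k) B - spectralMeasure B (Set.Ici l)) x⟫_ℂ).re := by
      simpa using re_inner_mono hnn x
    have h6 := h3.trans (mul_le_mul_of_nonneg_right h4 h5)
    simpa [inner_sub_right] using h6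
  have h7 := (Real.continuous_sqrt.tendsto 0).comp h2
  simpa [Function.comp_def] using h7

/-- An indicator is its own square: the squared ramps have the same pointwise limit as the ramps, so
‖E x‖² = ⟪x, E x⟫. Self-adjointness of `B` is not needed, since otherwise its real functional
calculus, and with it the spectral measure, is zero. -/
theorem isStarProjection_spectralMeasure_Ici (B : H →L[ℂ] H) (l : ℝ) :
    IsStarProjection (spectralMeasure B (Set.Ici l)) := by
  have hsa := isSelfAdjoint_spectralMeasure B (Set.Ici l)
  refine ⟨?_, hsa⟩
  have hadj : ∀ (T : H →L[ℂ] H), IsSelfAdjoint T → ∀ x, (⟪x, (T * T) x⟫_ℂ).re = ‖T x‖ ^ 2 :=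
    fun T hT x => by
      change (⟪x, T (T x)⟫_ℂ).re = _
      rw [← ContinuousLinearMap.adjoint_inner_left, hT.adjoint_eq]
      exact inner_self_eq_norm_sq (𝕜 := ℂ) _
  have hsq := IsSelfAdjoint.star_mul_self (spectralMeasure B (Set.Ici l))
  rw [hsa.star_eq] at hsq
  refine eq_of_re_inner_eq hsq hsa fun x => ?_
  have h1 : Tendsto (fun k => (⟪x, (cfc (ramp l k) B * cfc (ramp l k) B) x⟫_ℂ).re) atTop
      (𝓝 (⟪x, spectralMeasure B (Set.Ici l) x⟫_ℂ).re) := by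
    have e : ∀ k, (⟪x, (cfc (ramp l k) B * cfc (ramp l k) B) x⟫_ℂ).re =
        ∫ t, ramp l k t * ramp l k t ∂(scalarSpectralMeasure B x) := fun k => by
      have hc := continuous_ramp l k
      rw [← cfc_mul (ramp l k) (ramp l k) B hc.continuousOn hc.continuousOn,
        integral_scalarSpectralMeasure_of_bounded B x (φ := fun t => ramp l k t * ramp l k t)
          (hc.mul hc) (C := 1)]
      intro t
      rw [abs_mul]
      exact mul_le_one₀ (abs_ramp_le l k t) (abs_nonneg _) (abs_ramp_le l k t)
    simp only [e, re_inner_spectralMeasure]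
    rw [← integral_indicator_one measurableSet_Ici]
    refine tendsto_integral_of_dominated_convergence (fun _ => 1)
      (fun k => ((continuous_ramp l k).mul (continuous_ramp l k)).aestronglyMeasurable)
      (integrable_const _) (fun k => .of_forall fun t => ?_) (.of_forall fun t => ?_)
    · rw [norm_mul]
      exact mul_le_one₀ (abs_ramp_le l k t) (abs_nonneg _) (abs_ramp_le l k t)
    · have := (tendsto_ramp l t).mul (tendsto_ramp l t)
      convert this using 2
      by_cases ht : t ∈ Set.Ici l <;> simp [ht, Set.indicator]
  refine tendsto_nhds_unique ?_ h1
  simp only [hadj _ (cfc_predicate _ _ : IsSelfAdjoint (cfc (ramp l _) B)), hadj _ hsa]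
  exact (tendsto_cfc_ramp_apply B l x).norm.pow 2

/-- For `u` just below `l`, E_l ≤ E_u ≤ `cfc (ramp l k) B`, and the form of the upper bound is close
to that of E_l. As E_u - E_l is a projection, the gap between the forms bounds ‖(E_u - E_l) x‖². -/
theorem continuousWithinAt_spectralMeasure_Ici (B : H →L[ℂ] H) (x : H)
    (l : ℝ) :
    ContinuousWithinAt (fun u => spectralMeasure B (Set.Ici u) x) (Set.Iic l) l := by
  rw [ContinuousWithinAt, Metric.tendsto_nhds]
  intro ε hε
  have h1 := tendsto_re_inner_cfc_ramp B l x
  obtain ⟨k, hk, hk0⟩ := ((h1.eventually (gt_mem_nhds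
    (lt_add_of_pos_right _ (show 0 < ε ^ 2 by positivity)))).and (eventually_gt_atTop 0)).exists
  have hk0' : (0 : ℝ) < k := by exact_mod_cast hk0
  have hnear : ∀ᶠ u in 𝓝[≤] l, l - 1 / k < u :=
    eventually_nhdsWithin_of_eventually_nhds (lt_mem_nhds (by
      have : 0 < 1 / (k : ℝ) := by positivity
      linarith))
  filter_upwards [hnear, self_mem_nhdsWithin] with u hu hul
  have hle : spectralMeasure B (Set.Ici l) ≤ spectralMeasure B (Set.Ici u) :=
    spectralMeasure_mono B (Set.Ici_subset_Ici.2 hul)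
  have hku : -1 ≤ k * (u - l) := by
    have := mul_lt_mul_of_pos_left hu hk0'
    rw [mul_sub, mul_one_div_cancel hk0'.ne'] at this
    linarith
  have h2 := re_inner_mono (spectralMeasure_Ici_le_cfc_ramp B hku) x
  have hp := (isStarProjection_spectralMeasure_Ici B l).le_iff_sub
    (isStarProjection_spectralMeasure_Ici B u) |>.1 hle
  have h3 := norm_apply_sq_le hp.nonneg x
  have h4 : 0 ≤ (⟪x, (spectralMeasure B (Set.Ici u) - spectralMeasure B (Set.Ici l)) x⟫_ℂ).re := by
    simpa using re_inner_mono hp.nonneg x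
  have h5 := h3.trans (mul_le_mul_of_nonneg_right hp.norm_le h4)
  rw [dist_eq_norm]
  refine lt_of_pow_lt_pow_left₀ 2 hε.le ?_
  simp only [sub_apply, inner_sub_right, Complex.sub_re, one_mul] at h5
  linarith

theorem spectralMeasure_Ici_of_nonpos {B : H →L[ℂ] H} (hB : 0 ≤ B) {l : ℝ} (hl : l ≤ 0) :
    spectralMeasure B (Set.Ici l) = 1 := by
  ext x
  refine tendsto_nhds_unique (tendsto_cfc_ramp_apply B l x) (tendsto_const_nhds.congr fun k => ?_)
  rw [cfc_congr (g := fun _ => (1 : ℝ)) fun t ht =>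
    ramp_eq_one_of_le (hl.trans (spectrum_nonneg_of_nonneg hB ht)), cfc_const_one ℝ B]

/-- The ramps at 0 are squeezed between E([0, ∞)) = 1 and 1, hence equal 1 on the spectrum; but a
steep enough ramp vanishes at any given negative point. -/
theorem nonneg_of_spectralMeasure_Ici_zero {B : H →L[ℂ] H} (hB : IsSelfAdjoint B)
    (h : spectralMeasure B (Set.Ici 0) = 1) : 0 ≤ B := by
  rw [← cfc_id ℝ B]
  refine cfc_nonneg fun t ht => ?_
  by_contra! hneg
  simp only [id] at hneg
  obtain ⟨k, hk⟩ := exists_nat_ge (2 / (0 - t))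
  have h1 : cfc (ramp 0 k) B = cfc (fun _ => (1 : ℝ)) B := by
    rw [cfc_const_one ℝ B]
    refine le_antisymm (cfc_le_one (ramp 0 k) B fun t _ => ramp_le_one 0 k t) ?_
    rw [← h]
    exact spectralMeasure_Ici_le_cfc_ramp B (by simp)
  have h2 := (cfc_eq_cfc_iff_eqOn (ha := hB) (hf := (continuous_ramp 0 k).continuousOn)
    (hg := continuousOn_const)).1 h1 ht
  rw [div_le_iff₀ (by linarith)] at hk
  rw [ramp_eq_zero (by linarith)] at h2
  exact zero_ne_one h2

/-- The values on the half-lines `[l, ∞)`, `l > 0`, determine a positive operator. -/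
theorem eq_of_spectralMeasure_Ici_eq {B C : H →L[ℂ] H} (hB : 0 ≤ B) (hC : 0 ≤ C)
    (h : ∀ l, 0 < l → spectralMeasure B (Set.Ici l) = spectralMeasure C (Set.Ici l)) : B = C := by
  have hB' := IsSelfAdjoint.of_nonneg hB
  have hC' := IsSelfAdjoint.of_nonneg hC
  refine eq_of_re_inner_eq hB' hC' fun x => ?_
  have hμ : scalarSpectralMeasure B x = scalarSpectralMeasure C x := by
    refine Measure.ext_of_Ici _ _ fun l => ?_
    rw [← measureReal_eq_measureReal_iff, ← re_inner_spectralMeasure, ← re_inner_spectralMeasure]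
    rcases le_or_gt l 0 with hl | hl
    · rw [spectralMeasure_Ici_of_nonpos hB hl, spectralMeasure_Ici_of_nonpos hC hl]
    · rw [h l hl]
  let N := max ‖B‖ ‖C‖
  -- The identity, truncated to a bounded function without changing it on either spectrum.
  let φ : ℝ → ℝ := fun t => max (-N) (min N t)
  have hN : 0 ≤ N := (norm_nonneg B).trans (le_max_left _ _)
  have hφ : Continuous φ := by fun_prop
  have hφb : ∀ t, |φ t| ≤ N := fun t =>
    abs_le.2 ⟨le_max_left _ _, max_le (by linarith) (min_le_left _ _)⟩
  have key : ∀ T : H →L[ℂ] H, IsSelfAdjoint T → ‖T‖ ≤ N → cfc φ T = T := fun T hT hTN => by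
    conv_rhs => rw [← cfc_id ℝ T]
    refine cfc_congr fun t ht => ?_
    have h2 : |t| ≤ ‖T‖ := by
      by_cases hnt : Nontrivial (H →L[ℂ] H)
      · simpa using spectrum.norm_le_norm_of_mem ht
      · rw [not_nontrivial_iff_subsingleton] at hnt
        simp at ht
    obtain ⟨h3, h4⟩ := abs_le.1 (h2.trans hTN)
    simp [φ, h3, h4]
  have e1 := integral_scalarSpectralMeasure_of_bounded B x hφ hφb
  have e2 := integral_scalarSpectralMeasure_of_bounded C x hφ hφb
  rw [key B hB' (le_max_left _ _)] at e1
  rw [key C hC' (le_max_right _ _)] at e2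
  rw [← e1, ← e2, hμ]

end SpectralProjections

end SpectralShorted
namespace SpectralShorted

/-! ### Spectral projections compared through powers. -/

section SpectralOrder

open Filter Topology

variable {H : Type*} [NormedAddCommGroup H] [InnerProductSpace ℂ H] [CompleteSpace H]

/-- This is l^u χ_[l,∞)(t) ≤ t^u for t ≥ 0. The continuous ramp replaces the indicator at the cost
of lowering `l` to `l - 2 / k`, where the ramp's support begins; then `k → ∞`. -/
theorem rpow_smul_spectralMeasure_Ici_le {B : H →L[ℂ] H} (hB : 0 ≤ B) {l u : ℝ} (hl : 0 < l)
    (hu : 0 ≤ u) : l ^ u • spectralMeasure B (Set.Ici l) ≤ B ^ u := by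
  have hB' := IsSelfAdjoint.of_nonneg hB
  have hlim : Tendsto (fun k : ℕ => l - 2 / k) atTop (𝓝 l) := by
    simpa using (tendsto_const_div_atTop_nhds_zero_nat (2 : ℝ)).const_sub l
  refine le_of_tendsto_apply (l := atTop)
    (T := fun k : ℕ => (l - 2 / k) ^ u • spectralMeasure B (Set.Ici l)) (fun x => ?_) ?_
  · exact (hlim.rpow_const (.inl hl.ne')).smul_const _
  · filter_upwards [hlim.eventually (lt_mem_nhds hl), eventually_gt_atTop 0] with k hk hk0
    have hk0' : (0 : ℝ) < k := by exact_mod_cast hk0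
    have h1 : (l - 2 / k) ^ u • spectralMeasure B (Set.Ici l) ≤
        (l - 2 / k) ^ u • cfc (ramp l k) B :=
      smul_le_smul_of_nonneg_left (spectralMeasure_Ici_le_cfc_ramp B (by simp))
        (Real.rpow_nonneg hk.le _)
    have hc := (continuous_ramp l k).continuousOn (s := spectrum ℝ B)
    refine h1.trans ?_
    rw [← cfc_smul _ (ramp l k) B hc, CFC.rpow_eq_cfc_real hB]
    refine cfc_mono (fun t ht => ?_) (hf := hc.const_smul ((l - 2 / k) ^ u : ℝ))
      (hg := (Real.continuous_rpow_const hu).continuousOn)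
    have ht0 : 0 ≤ t := spectrum_nonneg_of_nonneg hB ht
    rw [smul_eq_mul]
    rcases le_or_gt (k * (t - l)) (-2) with h | h
    · rw [ramp_eq_zero h, mul_zero]
      exact Real.rpow_nonneg ht0 _
    · have h2 : l - 2 / k ≤ t := by
        rw [sub_le_iff_le_add, ← sub_le_iff_le_add', le_div_iff₀ hk0']
        linarith
      calc (l - 2 / k) ^ u * ramp l k t ≤ (l - 2 / k) ^ u * 1 :=
            mul_le_mul_of_nonneg_left (ramp_le_one l k t) (Real.rpow_nonneg hk.le _)
        _ ≤ t ^ u := by rw [mul_one]; exact Real.rpow_le_rpow hk.le h2 hu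

/-- A projection lies below the spectral projection of `[l, ∞)` if all its multiples by powers of
`l` lie below the powers of the operator. -/
theorem le_spectralMeasure_Ici {B Q : H →L[ℂ] H} (hB : 0 ≤ B) (hQ : IsStarProjection Q) {l : ℝ}
    (hl : 0 < l) (h : ∀ n : ℕ, l ^ n • Q ≤ B ^ n) : Q ≤ spectralMeasure B (Set.Ici l) := by
  rw [hQ.le_iff_mul_eq_left (isStarProjection_spectralMeasure_Ici B l)]
  have hB' := IsSelfAdjoint.of_nonneg hB
  have hlim : Tendsto (fun k : ℕ => l - 1 / k) atTop (𝓝 l) := by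
    simpa using (tendsto_const_div_atTop_nhds_zero_nat (1 : ℝ)).const_sub l
  have key : ∀ᶠ k : ℕ in atTop, ∀ z, Q (z - cfc (ramp l k) B z) = 0 := by
    filter_upwards [hlim.eventually (lt_mem_nhds hl), eventually_gt_atTop 0] with k hk hk0 z
    have hk0' : (0 : ℝ) < k := by exact_mod_cast hk0
    set c := l - 1 / (k : ℝ) with hc
    have hcl : c < l := by
      have : 0 < 1 / (k : ℝ) := by positivity
      linarith
    have hr := (continuous_ramp l k).continuousOn (s := spectrum ℝ B)
    -- `g` vanishes on [c, ∞), so `g(B) B^n g(B) ≤ c^n`, whereas the hypothesis bounds the form of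
    -- B^n below by l^n times that of `Q`. Since `c < l`, letting `n → ∞` forces `Q g(B) = 0`.
    set g : ℝ → ℝ := fun t => 1 - ramp l k t with hg
    have hgc : ContinuousOn g (spectrum ℝ B) := continuousOn_const.sub hr
    have hD : z - cfc (ramp l k) B z = cfc g B z := by
      rw [hg, cfc_sub (fun _ => (1 : ℝ)) (ramp l k) B, cfc_const_one ℝ B]
      rfl
    have hDsa : IsSelfAdjoint (cfc g B) := cfc_predicate _ _
    have hn : ∀ n : ℕ, l ^ n * (⟪cfc g B z, Q (cfc g B z)⟫_ℂ).re ≤ c ^ n * ‖z‖ ^ 2 := by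
      intro n
      have h1 := re_inner_mono (h n) (cfc g B z)
      have h2 : cfc g B * B ^ n * cfc g B ≤ c ^ n • 1 := by
        have e : cfc (fun t => g t * t ^ n * g t) B = cfc g B * B ^ n * cfc g B := by
          have hp : ContinuousOn (fun t : ℝ => t ^ n) (spectrum ℝ B) := by fun_prop
          rw [cfc_mul (fun t => g t * t ^ n) g B (hgc.mul hp) hgc, cfc_mul g _ B hgc hp,
            cfc_pow_id B n]
        have e' : cfc (fun _ => c ^ n) B = c ^ n • (1 : H →L[ℂ] H) := by
          rw [cfc_const _ B, Algebra.algebraMap_eq_smul_one]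
        rw [← e, ← e']
        refine cfc_mono (fun t ht => ?_) (hf := by fun_prop)
        have ht0 : 0 ≤ t := spectrum_nonneg_of_nonneg hB ht
        rcases le_or_gt (-1) (k * (t - l)) with h3 | h3
        · simp only [hg, ramp_eq_one h3, sub_self, zero_mul]
          exact pow_nonneg hk.le n
        · have h4 : t ≤ c := by
            rw [hc, le_sub_iff_add_le, ← le_sub_iff_add_le', div_le_iff₀ hk0']
            linarith
          have hg0 : 0 ≤ g t := sub_nonneg.2 (ramp_le_one l k t)
          have hg1 : g t ≤ 1 := sub_le_self _ (ramp_nonneg l k t)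
          calc g t * t ^ n * g t ≤ 1 * t ^ n * 1 := by gcongr
            _ ≤ c ^ n := by rw [one_mul, mul_one]; gcongr
      have h5 := re_inner_mono h2 z
      have h6 : ⟪z, (cfc g B * B ^ n * cfc g B) z⟫_ℂ = ⟪cfc g B z, (B ^ n) (cfc g B z)⟫_ℂ := by
        change ⟪z, cfc g B ((B ^ n) (cfc g B z))⟫_ℂ = _
        rw [← ContinuousLinearMap.adjoint_inner_left, hDsa.adjoint_eq]
      have h7 : (⟪z, (c ^ n • (1 : H →L[ℂ] H)) z⟫_ℂ).re = c ^ n * ‖z‖ ^ 2 := by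
        change (⟪z, c ^ n • z⟫_ℂ).re = _
        rw [inner_smul_right_eq_smul, Complex.smul_re, smul_eq_mul]
        congr 1
        exact inner_self_eq_norm_sq (𝕜 := ℂ) _
      have h8 : (⟪cfc g B z, (l ^ n • Q) (cfc g B z)⟫_ℂ).re =
          l ^ n * (⟪cfc g B z, Q (cfc g B z)⟫_ℂ).re := by
        rw [smul_apply, inner_smul_right_eq_smul, Complex.smul_re, smul_eq_mul]
      rw [h6, h7] at h5
      rw [h8] at h1
      exact h1.trans h5
    rw [hD]
    refine apply_eq_zero_of_re_inner hQ.nonneg ?_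
    have hlim0 : Tendsto (fun n : ℕ => (c / l) ^ n * ‖z‖ ^ 2) atTop (𝓝 0) := by
      simpa using (tendsto_pow_atTop_nhds_zero_of_lt_one (div_nonneg hk.le hl.le)
        ((div_lt_one hl).2 hcl)).mul_const (‖z‖ ^ 2)
    refine ge_of_tendsto' hlim0 fun n => ?_
    rw [div_pow, div_mul_eq_mul_div, le_div_iff₀ (by positivity), mul_comm]
    exact hn n
  ext z
  have h1 : Tendsto (fun k => Q (z - cfc (ramp l k) B z)) atTop
      (𝓝 (Q (z - spectralMeasure B (Set.Ici l) z))) :=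
    (Q.continuous.tendsto _).comp (tendsto_const_nhds.sub (tendsto_cfc_ramp_apply B l z))
  have h2 := tendsto_nhds_unique h1
    (tendsto_const_nhds.congr' (key.mono fun k hk => (hk z).symm))
  rw [map_sub, sub_eq_zero] at h2
  exact h2.symm

/-- A nonzero projection has norm 1, so `l E ≤ B` would give `l ≤ ‖B‖`. -/
theorem spectralMeasure_Ici_eq_zero {B : H →L[ℂ] H} (hB : 0 ≤ B) {l : ℝ} (hl : ‖B‖ < l) :
    spectralMeasure B (Set.Ici l) = 0 := by
  have h0 := (norm_nonneg B).trans_lt hl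
  have h1 := rpow_smul_spectralMeasure_Ici_le hB h0 zero_le_one
  rw [Real.rpow_one, CFC.rpow_one B] at h1
  have hp := isStarProjection_spectralMeasure_Ici B l
  have h2 := CStarAlgebra.norm_le_norm_of_nonneg_of_le
    (smul_nonneg h0.le (spectralMeasure_nonneg B (Set.Ici l))) h1
  rw [norm_smul, Real.norm_of_nonneg h0.le] at h2
  by_contra hne
  have h3 : 0 < ‖spectralMeasure B (Set.Ici l)‖ := norm_pos_iff.2 hne
  have h4 : ‖spectralMeasure B (Set.Ici l)‖ ^ 2 = ‖spectralMeasure B (Set.Ici l)‖ := by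
    rw [← hp.isSelfAdjoint.norm_mul_self, hp.isIdempotentElem.eq]
  have h5 : ‖spectralMeasure B (Set.Ici l)‖ = 1 := by
    simpa [pow_two, hne] using h4
  rw [h5] at h2
  linarith

theorem isLeftSpectralResolution_spectralMeasure {B : H →L[ℂ] H} (hB : 0 ≤ B) :
    IsLeftSpectralResolution fun l => spectralMeasure B (Set.Ici l) where
  bounds := ⟨0, ‖B‖, fun _ hl => spectralMeasure_Ici_of_nonpos hB hl.le,
    fun _ hl => spectralMeasure_Ici_eq_zero hB hl⟩
  projection := isStarProjection_spectralMeasure_Ici B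
  antitone _ _ h := spectralMeasure_mono B (Set.Ici_subset_Ici.2 h)
  left_continuous x l := continuousWithinAt_spectralMeasure_Ici B x l

end SpectralOrder

/-! ### Ranges, meets and powers of projections. -/

section Projections

variable {H : Type*} [NormedAddCommGroup H] [InnerProductSpace ℂ H] [CompleteSpace H]

theorem isStarProjection_orthProj (K : Submodule ℂ H) : IsStarProjection (orthProj K) :=
  isStarProjection_starProjection

theorem orthProj_apply_eq_self_iff {K : Submodule ℂ H} (hK : IsClosed (K : Set H)) {x : H} :
    orthProj K x = x ↔ x ∈ K := by
  rw [orthProj, Submodule.starProjection_eq_self_iff, hK.submodule_topologicalClosure_eq]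

theorem range_orthProj {K : Submodule ℂ H} (hK : IsClosed (K : Set H)) :
    (orthProj K).range = K := by
  rw [orthProj, Submodule.range_starProjection, hK.submodule_topologicalClosure_eq]

theorem mem_range_iff_of_isStarProjection {P : H →L[ℂ] H} (hP : IsStarProjection P) {x : H} :
    x ∈ P.range ↔ P x = x := by
  refine ⟨?_, fun h => ⟨x, h⟩⟩
  rintro ⟨y, rfl⟩
  exact congrArg (fun T : H →L[ℂ] H => T y) hP.isIdempotentElem.eq

theorem le_iff_range_le {P Q : H →L[ℂ] H} (hP : IsStarProjection P) (hQ : IsStarProjection Q) :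
    P ≤ Q ↔ P.range ≤ Q.range := by
  rw [hP.le_iff_mul_eq_right hQ]
  constructor
  · rintro h _ ⟨x, rfl⟩
    exact (mem_range_iff_of_isStarProjection hQ).2 (congrArg (fun T : H →L[ℂ] H => T x) h)
  · intro h
    ext x
    exact (mem_range_iff_of_isStarProjection hQ).1 (h ⟨x, rfl⟩)

theorem range_projMeet {P Q : H →L[ℂ] H} (hP : IsStarProjection P) (hQ : IsStarProjection Q) :
    (projMeet P Q).range = P.range ⊓ Q.range := by
  have hcl : ∀ {T : H →L[ℂ] H}, IsStarProjection T → IsClosed (T.range : Set H) := fun {T} hT => by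
    have : (T.range : Set H) = {x | T x = x} := by
      ext x
      exact mem_range_iff_of_isStarProjection hT
    rw [this]
    exact isClosed_eq T.continuous continuous_id
  exact range_orthProj ((hcl hP).inter (hcl hQ))

theorem smul_rpow_of_isStarProjection {Q : H →L[ℂ] H} (hQ : IsStarProjection Q) {c r : ℝ}
    (hc : 0 ≤ c) (hr : 0 < r) : (c • Q) ^ r = c ^ r • Q := by
  have hsa := hQ.isSelfAdjoint
  have h1 : c • Q = cfc (fun t : ℝ => c * t) Q := (cfc_const_mul_id c Q).symm
  rw [CFC.rpow_eq_cfc_real (smul_nonneg hc hQ.nonneg), h1,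
    ← cfc_comp' (fun t : ℝ => t ^ r) (fun t : ℝ => c * t) Q
      (Real.continuous_rpow_const hr.le).continuousOn (by fun_prop) hsa,
    ← cfc_const_mul_id (c ^ r) Q]
  refine cfc_congr fun t ht => ?_
  -- The spectrum lies in {0, 1}; at 0 the identity needs `r ≠ 0`, because 0^0 = 1.
  rcases hQ.isIdempotentElem.spectrum_subset ℝ ht with h | h
  · simp [h, Real.zero_rpow hr.ne']
  · rw [Set.mem_singleton_iff.1 h]
    simp

end Projections

/-! ### Existence of the shorted operator and ranges of its powers. -/

section Shorted

open Filter Topology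

variable {H : Type*} [NormedAddCommGroup H] [InnerProductSpace ℂ H] [CompleteSpace H]

/-- With C = B^(1/2) and M = C⁻¹(S), the maximum is C P_M C. A competitor Y vanishes on Sᗮ, so ⟪x, Y
x⟫ ≤ ‖C(x - z)‖² for every z in Sᗮ. Since Mᗮ lies in the closure of C(Sᗮ), approximating the
Mᗮ-component of C x by such C z brings the bound down to ‖P_M C x‖², the form of C P_M C. -/
theorem exists_isShorted {S : Submodule ℂ H} (hS : IsClosed (S : Set H)) {B : H →L[ℂ] H}
    (hB : 0 ≤ B) : ∃ X, IsShorted S B X := by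
  set C := CFC.sqrt B with hC
  have hCsa : IsSelfAdjoint C := IsSelfAdjoint.of_nonneg (CFC.sqrt_nonneg B)
  have hCC : C * C = B := CFC.sqrt_mul_sqrt_self B hB
  have hsymm : ∀ x y, ⟪C x, y⟫_ℂ = ⟪x, C y⟫_ℂ := fun x y => by
    rw [← ContinuousLinearMap.adjoint_inner_left, hCsa.adjoint_eq]
  have hS' : CompleteSpace S := hS.completeSpace_coe
  set M : Submodule ℂ H := S.comap C.toLinearMap with hM
  have hMc : IsClosed (M : Set H) := hS.preimage C.continuous
  have hM' : CompleteSpace M := hMc.completeSpace_coe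
  have hP : IsStarProjection M.starProjection := isStarProjection_starProjection
  refine ⟨C * M.starProjection * C, ⟨hCsa.conjugate_nonneg hP.nonneg, ?_, ?_⟩, ?_⟩
  · have := hCsa.conjugate_le_conjugate hP.le_one
    rwa [mul_one, hCC] at this
  · rintro _ ⟨v, rfl⟩
    exact M.starProjection_apply_mem (C v)
  · rintro Y ⟨hY, hYB, hYS⟩
    have hYsa := IsSelfAdjoint.of_nonneg hY
    have hYz := (range_le_iff hYsa hS).1 hYS
    rw [le_iff_re_inner hYsa (IsSelfAdjoint.of_nonneg (hCsa.conjugate_nonneg hP.nonneg))]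
    intro x
    have hX : (⟪x, (C * M.starProjection * C) x⟫_ℂ).re = ‖M.starProjection (C x)‖ ^ 2 := by
      change (⟪x, C (M.starProjection (C x))⟫_ℂ).re = _
      rw [← hsymm]
      have := M.re_inner_starProjection_eq_normSq (C x)
      rw [← inner_re_symm] at this
      exact this
    set N : Submodule ℂ H := Sᗮ.map C.toLinearMap with hN
    have hNM : Mᗮ ≤ N.topologicalClosure := by
      rw [← Submodule.orthogonal_orthogonal_eq_closure]
      refine Submodule.orthogonal_le fun v hv => ?_
      change C v ∈ S
      rw [← Submodule.orthogonal_orthogonal S]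
      intro z hz
      rw [← hsymm]
      exact hv _ ⟨z, hz, rfl⟩
    have hbound : ∀ v ∈ N, (⟪x, Y x⟫_ℂ).re ≤ ‖C x - v‖ ^ 2 := by
      rintro _ ⟨z, hz, rfl⟩
      change _ ≤ ‖C x - C z‖ ^ 2
      have h1 : ‖C x - C z‖ ^ 2 = (⟪x - z, B (x - z)⟫_ℂ).re := by
        rw [← map_sub, ← hCC]
        change _ = (⟪x - z, C (C (x - z))⟫_ℂ).re
        rw [← hsymm]
        exact (inner_self_eq_norm_sq (𝕜 := ℂ) _).symm
      have h2 : ⟪x - z, Y (x - z)⟫_ℂ = ⟪x, Y x⟫_ℂ := by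
        rw [map_sub, hYz z hz, sub_zero, inner_sub_left,
          Submodule.inner_left_of_mem_orthogonal (hYS ⟨x, rfl⟩ : Y x ∈ S) hz, sub_zero]
      rw [h1, ← h2]
      exact re_inner_mono hYB _
    have hclosed : IsClosed {v : H | (⟪x, Y x⟫_ℂ).re ≤ ‖C x - v‖ ^ 2} :=
      isClosed_le continuous_const (by fun_prop)
    have h3 : C x - M.starProjection (C x) ∈ {v : H | (⟪x, Y x⟫_ℂ).re ≤ ‖C x - v‖ ^ 2} :=
      closure_minimal (fun v hv => hbound v hv) hclosed
        (hNM (M.sub_starProjection_mem_orthogonal (C x)))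
    rw [hX]
    simpa using h3

theorem isShorted_shorted {S : Submodule ℂ H} (hS : IsClosed (S : Set H)) {B : H →L[ℂ] H}
    (hB : 0 ≤ B) : IsShorted S B (shorted S B) := by
  have h := exists_isShorted hS hB
  rw [shorted, dif_pos h]
  exact h.choose_spec

/-- Here X = P X P, so it suffices to compress `X ≤ ‖X‖` by P. -/
theorem le_norm_smul_orthProj {S : Submodule ℂ H} (hS : IsClosed (S : Set H)) {X : H →L[ℂ] H}
    (hX : 0 ≤ X) (hXS : X.range ≤ S) : X ≤ ‖X‖ • orthProj S := by
  have hXsa := IsSelfAdjoint.of_nonneg hX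
  have hP := isStarProjection_orthProj S
  have h1 : orthProj S * X = X := by
    ext x
    exact (orthProj_apply_eq_self_iff hS).2 (hXS ⟨x, rfl⟩)
  have h2 : X * orthProj S = X := by
    have := congrArg star h1
    rwa [star_mul, hXsa.star_eq, hP.isSelfAdjoint.star_eq] at this
  have h3 := hP.isSelfAdjoint.conjugate_le_conjugate (hXsa.le_algebraMap_norm_self)
  rwa [h1, h2, Algebra.algebraMap_eq_smul_one, mul_smul_comm, mul_one, smul_mul_assoc,
    hP.isIdempotentElem.eq] at h3

/-- Löwner–Heinz applied to X ≤ ‖X‖ P gives X^r ≤ ‖X‖^r P, so the form of X^r vanishes on Sᗮ. -/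
theorem range_rpow_le {S : Submodule ℂ H} (hS : IsClosed (S : Set H)) {X : H →L[ℂ] H} (hX : 0 ≤ X)
    (hXS : X.range ≤ S) {r : ℝ} (hr : 0 < r) (hr1 : r ≤ 1) : (X ^ r).range ≤ S := by
  have hP := isStarProjection_orthProj S
  have hXr : 0 ≤ X ^ r := CFC.rpow_nonneg
  have h4 : X ^ r ≤ ‖X‖ ^ r • orthProj S := by
    have := CFC.rpow_le_rpow (p := r) ⟨hr.le, hr1⟩ (le_norm_smul_orthProj hS hX hXS)
    rwa [smul_rpow_of_isStarProjection hP (norm_nonneg X) hr] at this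
  rw [range_le_iff (IsSelfAdjoint.of_nonneg hXr) hS]
  intro z hz
  have h5 : orthProj S z = 0 :=
    (range_le_iff hP.isSelfAdjoint hS).1 (range_orthProj hS).le z hz
  refine apply_eq_zero_of_re_inner hXr ((re_inner_mono h4 z).trans ?_)
  rw [smul_apply, h5, smul_zero, inner_zero_right, Complex.zero_re]

/-! ### The family Σ(S, A^t)^(1/t) and its limit. -/

variable {S : Submodule ℂ H} {A : H →L[ℂ] H}

theorem shorted_rpow_spec (hS : IsClosed (S : Set H)) (t : ℝ) :
    0 ≤ shorted S (A ^ t) ∧ shorted S (A ^ t) ≤ A ^ t ∧ (shorted S (A ^ t)).range ≤ S :=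
  (isShorted_shorted hS CFC.rpow_nonneg).1

theorem shortedPower_rpow (hS : IsClosed (S : Set H)) {t s : ℝ} (ht : 0 < t) (hs : 0 ≤ s) :
    shortedPower S A t ^ s = shorted S (A ^ t) ^ (s / t) := by
  rw [shortedPower, CFC.rpow_rpow_of_exponent_nonneg _ _ _ (by positivity) hs
    (shorted_rpow_spec hS t).1, one_div_mul_eq_div]

theorem shortedPower_rpow_le (hS : IsClosed (S : Set H)) (hA : 0 ≤ A) {s t : ℝ} (ht : 0 < t)
    (hs : 0 ≤ s) (hst : s ≤ t) : shortedPower S A t ^ s ≤ A ^ s := by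
  rw [shortedPower_rpow hS ht hs]
  have h := CFC.rpow_le_rpow ⟨div_nonneg hs ht.le, (div_le_one ht).2 hst⟩
    (shorted_rpow_spec (A := A) hS t).2.1
  rwa [CFC.rpow_rpow_of_exponent_nonneg A _ _ ht.le (div_nonneg hs ht.le) hA,
    mul_div_cancel₀ _ ht.ne'] at h

theorem range_shortedPower_le (hS : IsClosed (S : Set H)) {t : ℝ} (ht : 1 ≤ t) :
    (shortedPower S A t).range ≤ S :=
  range_rpow_le hS (shorted_rpow_spec hS t).1 (shorted_rpow_spec hS t).2.2
    (by positivity) ((div_le_one (by linarith)).2 ht)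

/-- The `s`-th power of the later operator competes in the maximum defining Σ(S, A^s); the exponent
1/s ≤ 1 then preserves the inequality. -/
theorem shortedPower_anti (hS : IsClosed (S : Set H)) (hA : 0 ≤ A) {s t : ℝ} (hs : 1 ≤ s)
    (hst : s ≤ t) : shortedPower S A t ≤ shortedPower S A s := by
  have hs0 : 0 < s := by linarith
  have ht0 : 0 < t := by linarith
  have h1 : shortedPower S A t ^ s ≤ shorted S (A ^ s) := by
    refine (isShorted_shorted hS CFC.rpow_nonneg).2 ⟨CFC.rpow_nonneg,
      shortedPower_rpow_le hS hA ht0 hs0.le hst, ?_⟩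
    rw [shortedPower_rpow hS ht0 hs0.le]
    exact range_rpow_le hS (shorted_rpow_spec hS t).1 (shorted_rpow_spec hS t).2.2
      (by positivity) ((div_le_one ht0).2 hst)
  have h2 := CFC.rpow_le_rpow (p := 1 / s) ⟨by positivity, (div_le_one hs0).2 hs⟩ h1
  have hnn : 0 ≤ shortedPower S A t := CFC.rpow_nonneg
  rwa [CFC.rpow_rpow_of_exponent_nonneg _ _ _ hs0.le (by positivity) hnn,
    mul_one_div_cancel hs0.ne', CFC.rpow_one _ hnn] at h2

/-- The multiple `l ^ t • Q` lies below A^t and has range in S, hence lies below Σ(S, A^t); raise to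
the power s/t ≤ 1. -/
theorem pow_smul_le_shortedPower_pow (hS : IsClosed (S : Set H)) (hA : 0 ≤ A) {Q : H →L[ℂ] H}
    (hQ : IsStarProjection Q) {l : ℝ} (hl : 0 < l) (hQA : Q ≤ spectralMeasure A (Set.Ici l))
    (hQS : Q.range ≤ S) {s t : ℝ} (hs : 0 < s) (hst : s ≤ t) :
    l ^ s • Q ≤ shortedPower S A t ^ s := by
  have ht : 0 < t := hs.trans_le hst
  have hlt : 0 ≤ l ^ t := Real.rpow_nonneg hl.le t
  have h1 : l ^ t • Q ≤ shorted S (A ^ t) := by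
    refine (isShorted_shorted hS CFC.rpow_nonneg).2 ⟨smul_nonneg hlt hQ.nonneg,
      (smul_le_smul_of_nonneg_left hQA hlt).trans
        (rpow_smul_spectralMeasure_Ici_le hA hl ht.le), ?_⟩
    rintro _ ⟨x, rfl⟩
    change l ^ t • Q x ∈ S
    rw [← Complex.coe_smul]
    exact S.smul_mem _ (hQS ⟨x, rfl⟩)
  have h2 := CFC.rpow_le_rpow (p := s / t) ⟨by positivity, (div_le_one ht).2 hst⟩ h1
  rwa [smul_rpow_of_isStarProjection hQ hlt (by positivity), ← Real.rpow_mul hl.le,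
    mul_div_cancel₀ _ ht.ne', ← shortedPower_rpow hS ht hs.le] at h2

/-- The strong limit of the decreasing family is also its infimum, since the order is closed under
strong limits. -/
theorem exists_isSpectralShorted (hS : IsClosed (S : Set H)) (hA : 0 ≤ A) :
    ∃ R, IsSpectralShorted S A R := by
  obtain ⟨R, hR⟩ := exists_tendsto_of_antitoneOn (T := shortedPower S A) (a := 1)
    (fun t _ => CFC.rpow_nonneg) (fun s t hs hst => shortedPower_anti hS hA hs hst)
  refine ⟨R, ⟨?_, fun L hL => ?_⟩, hR⟩
  · rintro _ ⟨s, hs, rfl⟩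
    refine le_of_tendsto_apply hR ?_
    filter_upwards [eventually_ge_atTop s] with t ht
    exact shortedPower_anti hS hA hs ht
  · refine ge_of_tendsto_apply hR ?_
    filter_upwards [eventually_ge_atTop 1] with t ht
    exact hL ⟨t, ht, rfl⟩

theorem isSpectralShorted_spectralShorted (hS : IsClosed (S : Set H)) (hA : 0 ≤ A) :
    IsSpectralShorted S A (spectralShorted S A) := by
  have h := exists_isSpectralShorted hS hA
  rw [spectralShorted, dif_pos h]
  exact h.choose_spec

theorem IsSpectralShorted.nonneg {R : H →L[ℂ] H} (hR : IsSpectralShorted S A R) : 0 ≤ R :=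
  hR.1.2 (by rintro _ ⟨t, -, rfl⟩; exact CFC.rpow_nonneg)

theorem IsSpectralShorted.tendsto_pow {R : H →L[ℂ] H} (hS : IsClosed (S : Set H)) (hA : 0 ≤ A)
    (hR : IsSpectralShorted S A R) (n : ℕ) (x : H) :
    Tendsto (fun t => (shortedPower S A t ^ n) x) atTop (𝓝 ((R ^ n) x)) := by
  refine tendsto_pow_apply (C := ‖shortedPower S A 1‖) ?_ hR.2 n x
  filter_upwards [eventually_ge_atTop 1] with t ht
  exact CStarAlgebra.norm_le_norm_of_nonneg_of_le CFC.rpow_nonneg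
    (shortedPower_anti hS hA le_rfl ht)

/-- All powers are needed: R ≤ A alone would not order the spectral projections. Each `n` is handled
by the indices t ≥ n, where n/t ≤ 1 is an admissible Löwner–Heinz exponent. -/
theorem IsSpectralShorted.pow_le {R : H →L[ℂ] H} (hS : IsClosed (S : Set H)) (hA : 0 ≤ A)
    (hR : IsSpectralShorted S A R) (n : ℕ) : R ^ n ≤ A ^ n := by
  refine le_of_tendsto_apply (hR.tendsto_pow hS hA n) ?_
  filter_upwards [eventually_ge_atTop (n : ℝ), eventually_gt_atTop 0] with t hn ht
  rw [← CFC.rpow_natCast (shortedPower S A t) n CFC.rpow_nonneg, ← CFC.rpow_natCast A n hA]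
  exact shortedPower_rpow_le hS hA ht n.cast_nonneg hn

theorem IsSpectralShorted.range_le {R : H →L[ℂ] H} (hS : IsClosed (S : Set H))
    (hR : IsSpectralShorted S A R) : R.range ≤ S := by
  rintro _ ⟨x, rfl⟩
  refine hS.mem_of_tendsto (hR.2 x) ?_
  filter_upwards [eventually_ge_atTop 1] with t ht
  exact range_shortedPower_le hS ht ⟨x, rfl⟩

theorem IsSpectralShorted.spectralMeasure_Ici {R : H →L[ℂ] H} (hS : IsClosed (S : Set H))
    (hA : 0 ≤ A) (hR : IsSpectralShorted S A R) {l : ℝ} (hl : 0 < l) :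
    spectralMeasure R (Set.Ici l) = projMeet (spectralMeasure A (Set.Ici l)) (orthProj S) := by
  have hE := isStarProjection_spectralMeasure_Ici R l
  have hEA := isStarProjection_spectralMeasure_Ici A l
  have hP := isStarProjection_orthProj S
  have hQ : IsStarProjection (projMeet (spectralMeasure A (Set.Ici l)) (orthProj S)) :=
    isStarProjection_orthProj _
  have hrange := range_projMeet hEA hP
  rw [range_orthProj hS] at hrange
  have hpow : ∀ n : ℕ, l ^ n • spectralMeasure R (Set.Ici l) ≤ R ^ n := fun n => by
    have := rpow_smul_spectralMeasure_Ici_le hR.nonneg hl (n.cast_nonneg (α := ℝ))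
    rwa [Real.rpow_natCast, CFC.rpow_natCast R n hR.nonneg] at this
  refine le_antisymm ((le_iff_range_le hE hQ).2 (hrange ▸ le_inf ?_ ?_)) ?_
  · exact (le_iff_range_le hE hEA).1
      (le_spectralMeasure_Ici hA hE hl fun n => (hpow n).trans (hR.pow_le hS hA n))
  -- R vanishes on Sᗮ and `l E ≤ R` with `l > 0`, so E vanishes there too.
  · rw [range_le_iff hE.isSelfAdjoint hS]
    intro z hz
    have hRz := (range_le_iff (IsSelfAdjoint.of_nonneg hR.nonneg) hS).1 (hR.range_le hS) z hz
    have h1 := re_inner_mono (hpow 1) z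
    rw [pow_one, pow_one, hRz, inner_zero_right, smul_apply, inner_smul_right_eq_smul,
      Complex.smul_re, smul_eq_mul, Complex.zero_re] at h1
    exact apply_eq_zero_of_re_inner hE.nonneg (nonpos_of_mul_nonpos_right h1 hl)
  · refine le_spectralMeasure_Ici hR.nonneg hQ hl fun n => ?_
    -- The bound on powers of the family requires a positive exponent; for `n = 0` the claim is `Q ≤
    -- 1`.
    rcases n.eq_zero_or_pos with rfl | hn
    · simpa using hQ.le_one
    refine ge_of_tendsto_apply (hR.tendsto_pow hS hA n) ?_
    filter_upwards [eventually_ge_atTop (n : ℝ)] with t ht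
    rw [← CFC.rpow_natCast (shortedPower S A t) n CFC.rpow_nonneg, ← Real.rpow_natCast]
    exact pow_smul_le_shortedPower_pow hS hA hQ hl
      ((le_iff_range_le hQ hEA).2 (hrange.le.trans inf_le_left)) (hrange.le.trans inf_le_right)
      (by exact_mod_cast hn) ht

theorem IsSpectralShorted.shortedResolution_eq {R : H →L[ℂ] H} (hS : IsClosed (S : Set H))
    (hA : 0 ≤ A) (hR : IsSpectralShorted S A R) :
    shortedResolution S A = fun l => spectralMeasure R (Set.Ici l) := by
  funext l
  rw [shortedResolution]
  split_ifs with hl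
  · exact (hR.spectralMeasure_Ici hS hA hl).symm
  · exact (spectralMeasure_Ici_of_nonpos hR.nonneg (not_lt.1 hl)).symm

end Shorted

end SpectralShorted

theorem theorem4p1 {H : Type*} [NormedAddCommGroup H] [InnerProductSpace ℂ H] [CompleteSpace H]
    (A : H →L[ℂ] H) (hA : 0 ≤ A) (S : Submodule ℂ H) (hS : IsClosed (S : Set H)) :
    -- the shorted operators and the spectral shorted operator exist
    (∀ t : ℝ, 1 ≤ t →
      SpectralShorted.IsShorted S (A ^ t) (SpectralShorted.shorted S (A ^ t))) ∧
    SpectralShorted.IsSpectralShorted S A (SpectralShorted.spectralShorted S A) ∧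
    -- the spectral shorted operator is the operator defined by the left spectral resolution
    SpectralShorted.IsLeftSpectralResolution (SpectralShorted.shortedResolution S A) ∧
    (∀ B : H →L[ℂ] H, SpectralShorted.IsOperatorOf (SpectralShorted.shortedResolution S A) B ↔
      B = SpectralShorted.spectralShorted S A) ∧
    -- the formula for the spectral projections, which determines the spectral shorted operator
    (∀ l : ℝ, 0 < l →
      SpectralShorted.spectralMeasure (SpectralShorted.spectralShorted S A) (Set.Ici l) =
        SpectralShorted.projMeet (SpectralShorted.spectralMeasure A (Set.Ici l))
          (SpectralShorted.orthProj S)) ∧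
    (∀ B : H →L[ℂ] H, 0 ≤ B →
      (∀ l : ℝ, 0 < l → SpectralShorted.spectralMeasure B (Set.Ici l) =
        SpectralShorted.projMeet (SpectralShorted.spectralMeasure A (Set.Ici l))
          (SpectralShorted.orthProj S)) →
      B = SpectralShorted.spectralShorted S A) := by
  have hR := SpectralShorted.isSpectralShorted_spectralShorted hS hA
  have hres := hR.shortedResolution_eq hS hA
  have huniq : ∀ B : H →L[ℂ] H, 0 ≤ B →
      (∀ l : ℝ, 0 < l → SpectralShorted.spectralMeasure B (Set.Ici l) =
        SpectralShorted.projMeet (SpectralShorted.spectralMeasure A (Set.Ici l))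
          (SpectralShorted.orthProj S)) →
      B = SpectralShorted.spectralShorted S A := fun B hB h =>
    SpectralShorted.eq_of_spectralMeasure_Ici_eq hB hR.nonneg fun l hl =>
      (h l hl).trans (hR.spectralMeasure_Ici hS hA hl).symm
  refine ⟨fun t _ => SpectralShorted.isShorted_shorted hS CFC.rpow_nonneg, hR, ?_, fun B => ?_,
    fun l hl => hR.spectralMeasure_Ici hS hA hl, huniq⟩
  · rw [hres]
    exact SpectralShorted.isLeftSpectralResolution_spectralMeasure hR.nonneg
  · constructor
    · rintro ⟨hB, h⟩
      -- The value I of the resolution at 0 forces `B ≥ 0`, so uniqueness among positive operators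
      -- applies.
      refine huniq B (SpectralShorted.nonneg_of_spectralMeasure_Ici_zero hB ?_) fun l hl => ?_
      · rw [← h 0, SpectralShorted.shortedResolution, if_neg (lt_irrefl 0)]
      · rw [← h l, SpectralShorted.shortedResolution, if_pos hl]
    · rintro rfl
      exact ⟨IsSelfAdjoint.of_nonneg hR.nonneg, fun l => congrFun hres l⟩
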